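/- Let $G$ be a countable group, let $X$ be a compact metrizable space, and let $\rho: G\to \mathrm{Homeo}(X)$ be a homomorphism. Call a sequence $(g_i)_{i\in\mathbb N}$ of mutually different elements of $G$ a convergence sequence with repelling point $r\in X$ and attracting point $a\in X$ if $\rho(g_i)|_{X\setminus\{r\}}$ converges to $a$ uniformly on compact subsets of $X\setminus\{r\}$ and $\rho(g_i^{-1})|_{X\setminus\{a\}}$ converges to $r$ uniformly on compact subsets of $X\setminus\{a\}$ (here $r=a$ is allowed). Suppose that $\rho$ is a minimal non-elementary convergence group action, that is: $X$ has at least three points; every infinite sequence of mutually different elements of $G$ has a subsequence that is a convergence sequence; every orbit of $\rho(G)$ is dense in $X$; and the limit set, i.e. the set of all repelling points and attracting points of convergence sequences, is infinite. Let $R_a(G)$ be the amenable radical of $G$, i.e. its unique maximal amenable normal subgroup, which is the subgroup generated by all amenable normal subgroups. Then $R_a(G)$ is the greatest amenable normal subgroup of $G$, it is finite, and $R_a(G)=\ker\rho$. Moreover $G/R_a(G)$ is a strongly Powers group, i.e. each of its non-trivial subnormal subgroups is a Powers group. Here a group $H$ is called a Powers group if for every finite subset $F\subset H\setminus\{1\}$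 and every integer $N\ge 1$ there exist a partition $H=C\sqcup D$ and elements $\gamma_1,\dots,\gamma_N\in H$ such that $fC\cap C=\emptyset$ for all $f\in F$ and $\gamma_jD\cap\gamma_kD=\emptyset$ for all $j\neq k$. -/

import Mathlib

open Filter Topology
open scoped Pointwise

/-- A (discrete) group is amenable if it carries a finitely additive, left-invariant probability
measure defined on all of its subsets. -/
def IsAmenableGroup (G : Type*) [Group G] : Prop :=
  ∃ μ : Set G → NNReal,
    μ Set.univ = 1 ∧
    (∀ A B : Set G, Disjoint A B → μ (A ∪ B) = μ A + μ B) ∧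
    (∀ (g : G) (A : Set G), μ (g • A) = μ A)

/-- The amenable radical of a group: the subgroup generated by all amenable normal subgroups.
(It is itself amenable and normal, hence the greatest amenable normal subgroup.) -/
def amenableRadical (G : Type*) [Group G] : Subgroup G :=
  sSup {N : Subgroup G | N.Normal ∧ IsAmenableGroup N}

/-- The amenable radical is normal, so that the quotient by it is a group. -/
instance amenableRadical_normal (G : Type*) [Group G] : (amenableRadical G).Normal :=
  Subgroup.sSup_normal _ fun _ hN => hN.1

/-- A group `H` is a Powers group if for every finite `F ⊆ H \ {1}` and every `N ≥ 1` there are a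
partition `H = C ⊔ D` and elements `γ₁, …, γ_N` of `H` such that `f C ∩ C = ∅` for all `f ∈ F`
and `γ_j D ∩ γ_k D = ∅` for all `j ≠ k`. -/
def IsPowersGroup (H : Type*) [Group H] : Prop :=
  ∀ F : Finset H, (1 : H) ∉ F → ∀ N : ℕ, 1 ≤ N →
    ∃ C D : Set H, C ∪ D = Set.univ ∧ Disjoint C D ∧
      ∃ γ : Fin N → H,
        (∀ f ∈ F, Disjoint (f • C) C) ∧
        (∀ j k : Fin N, j ≠ k → Disjoint (γ j • D) (γ k • D))

/-- A group is a strongly Powers group if all its non-trivial subnormal subgroups are Powers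
groups. -/
def IsStronglyPowersGroup (H : Type*) [Group H] : Prop :=
  ∀ N : Subgroup H, N.IsSubnormal → N ≠ ⊥ → IsPowersGroup N

section ConvergenceActions

variable {G X : Type*} [Group G] [TopologicalSpace X] [CompactSpace X] [R1Space X]

/-- The maps `f n` converge to the constant `a` uniformly on every compact subset of `X \ {r}`.
Uniform convergence refers to the unique uniform structure of the compact Hausdorff space `X`
(the one of any metric inducing the topology). -/
def ConvergesOffPoint (f : ℕ → X ≃ₜ X) (r a : X) : Prop :=
  ∀ K : Set X, IsCompact K → K ⊆ {r}ᶜ →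
    @TendstoUniformlyOn X X ℕ uniformSpaceOfCompactR1 (fun n x => f n x) (fun _ => a) atTop K

/-- `g` is a convergence sequence of the action `ρ`, with repelling point `r` and attracting
point `a`. -/
def IsConvergenceSequence (ρ : G →* (X ≃ₜ X)) (g : ℕ → G) (r a : X) : Prop :=
  Function.Injective g ∧
    ConvergesOffPoint (fun n => ρ (g n)) r a ∧
    ConvergesOffPoint (fun n => ρ (g n)⁻¹) a r

/-- `ρ` is a convergence group action: `X` has at least three points, and every sequence of
mutually different elements of `G` has a subsequence which is a convergence sequence. -/
def IsConvergenceAction (ρ : G →* (X ≃ₜ X)) : Prop :=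
  (∃ x y z : X, x ≠ y ∧ y ≠ z ∧ x ≠ z) ∧
    ∀ g : ℕ → G, Function.Injective g →
      ∃ φ : ℕ → ℕ, StrictMono φ ∧ ∃ r a : X, IsConvergenceSequence ρ (g ∘ φ) r a

/-- The limit set of the action: the set of all repelling points and all attracting points of
convergence sequences. -/
def limitSet (ρ : G →* (X ≃ₜ X)) : Set X :=
  {x | ∃ (g : ℕ → G) (r a : X), IsConvergenceSequence ρ g r a ∧ (x = r ∨ x = a)}

/-- The action is non-elementary if its limit set is infinite. -/
def IsNonElementary (ρ : G →* (X ≃ₜ X)) : Prop :=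
  (limitSet ρ).Infinite

end ConvergenceActions

/-- An action by homeomorphisms is minimal if every orbit is dense. -/
def IsMinimalAction {G X : Type*} [Group G] [TopologicalSpace X] (ρ : G →* (X ≃ₜ X)) : Prop :=
  ∀ x : X, Dense (Set.range fun g : G => ρ g x)

/-!
Everything follows from three properties of a minimal convergence action of a group `G` on an
infinite compact Hausdorff space `X`.

* The kernel is finite, since the identity map does not contract `X ∖ {r}` to a point; more
  generally, elements fixing pointwise larger and larger parts of `X ∖ {a}` form a finite set
  (`finite_range_of_eventually_fixed`).
* If the action is faithful, every nontrivial normal subgroup `N` acts minimally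
  (`IsFaithfulMinimalConvergence.restrict_normal`). The set of fixed points of `N` is closed and
  `G`-invariant, hence empty. So `N` is infinite (for finite `N`, the attracting points of `G` would
  be fixed by `N`), its limit set is nonempty and `G`-invariant, hence dense, and it lies in the
  closure of every `N`-orbit. Consequently, the hypotheses pass to nontrivial subnormal subgroups.
* If the action is faithful, the fixed-point set of every `f ≠ 1` has empty interior
  (`interior_fixedPoints_eq_empty`): if `f` fixed an open set `U`, conjugating `f` by a convergence
  sequence with repelling point in `U` would produce elements fixing almost all of `X`.

By the last property, finitely many `f ≠ 1` have a common point that none of them fixes. So, for `F`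
finite with `1 ∉ F`, there is a nonempty open set `U` disjoint from all `f U`, `f ∈ F`. A convergence
sequence with repelling point in `U` shrinks `X ∖ U` towards a point `a`, whose orbit is infinite;
composing with elements that move `a` to `N` different points gives `γ₁, …, γ_N` for which the sets
`γ_j (X ∖ U)` are disjoint. The partition of `G` according to whether `g x₀ ∈ U` then shows that `G`
is a Powers group. As nontrivial Powers groups are not amenable, an amenable normal subgroup has
trivial image in the quotient by the kernel, so that the amenable radical is the kernel.
-/

/-! ### Minimal actions -/

section MinimalActions

variable {G H X : Type*} [Group G] [Group H] [TopologicalSpace X] {ρ : G →* (X ≃ₜ X)}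

lemma map_mul_apply (ρ : G →* (X ≃ₜ X)) (g h : G) (x : X) : ρ (g * h) x = ρ g (ρ h x) := by
  rw [map_mul]; rfl

lemma map_inv_apply_self (ρ : G →* (X ≃ₜ X)) (g : G) (x : X) : ρ g⁻¹ (ρ g x) = x := by
  rw [← map_mul_apply, inv_mul_cancel, map_one]; rfl

lemma map_apply_inv_self (ρ : G →* (X ≃ₜ X)) (g : G) (x : X) : ρ g (ρ g⁻¹ x) = x := by
  rw [← map_mul_apply, mul_inv_cancel, map_one]; rfl

lemma IsMinimalAction.dense_of_invariant (h : IsMinimalAction ρ) {S : Set X} (hS : S.Nonempty)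
    (hinv : ∀ g, ∀ x ∈ S, ρ g x ∈ S) : Dense S := by
  obtain ⟨x, hx⟩ := hS
  exact (h x).mono (by rintro _ ⟨g, rfl⟩; exact hinv g x hx)

lemma IsMinimalAction.infinite_orbit [T1Space X] [Infinite X] (h : IsMinimalAction ρ) (x : X) :
    (Set.range fun g : G => ρ g x).Infinite := by
  intro hfin
  have huniv := (h x).closure_eq
  rw [hfin.isClosed.closure_eq] at huniv
  exact Set.infinite_univ (huniv ▸ hfin)

lemma IsMinimalAction.infinite_group [T1Space X] [Infinite X] (h : IsMinimalAction ρ) :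
    Infinite G := by
  obtain ⟨x⟩ : Nonempty X := inferInstance
  by_contra hfin
  have : Finite G := not_infinite_iff_finite.1 hfin
  exact h.infinite_orbit x (Set.finite_range _)

lemma IsMinimalAction.of_comp {π : H →* G} (h : IsMinimalAction (ρ.comp π)) :
    IsMinimalAction ρ := fun x =>
  (h x).mono (by rintro _ ⟨g, rfl⟩; exact ⟨π g, rfl⟩)

end MinimalActions

/-! ### Convergence sequences -/

section ConvergenceSequences

variable {G H X : Type*} [Group G] [Group H] [TopologicalSpace X] [CompactSpace X]

lemma convergesOffPoint_iff [R1Space X] {f : ℕ → X ≃ₜ X} {r a : X} :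
    ConvergesOffPoint f r a ↔
      ∀ K : Set X, IsCompact K → K ⊆ {r}ᶜ → ∀ V ∈ 𝓝 a, ∀ᶠ n in atTop, ∀ x ∈ K, f n x ∈ V := by
  refine forall_congr' fun K => forall_congr' fun _ => forall_congr' fun _ => ?_
  let _ : UniformSpace X := uniformSpaceOfCompactR1
  constructor
  · intro h V hV
    obtain ⟨u, hu, huV⟩ := UniformSpace.mem_nhds_iff.1 hV
    exact (h u hu).mono fun n hn x hx => huV (hn x hx)
  · intro h u hu
    exact h _ (UniformSpace.ball_mem_nhds a hu)

lemma ConvergesOffPoint.tendsto [T2Space X] {f : ℕ → X ≃ₜ X} {r a x : X}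
    (h : ConvergesOffPoint f r a) (hx : x ≠ r) : Tendsto (fun n => f n x) atTop (𝓝 a) := by
  intro V hV
  exact (convergesOffPoint_iff.1 h {x} isCompact_singleton (by simpa using hx.symm) V hV).mono
    fun n hn => hn x rfl

lemma ConvergesOffPoint.conj [T2Space X] {f : ℕ → X ≃ₜ X} {r a : X}
    (h : ConvergesOffPoint f r a) (k : X ≃ₜ X) :
    ConvergesOffPoint (fun n => k * f n * k⁻¹) (k r) (k a) := by
  rw [convergesOffPoint_iff] at h ⊢
  intro K hK hKr V hV
  have hk : ∀ x, k (k⁻¹ x) = x := k.apply_symm_apply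
  have hKr' : (k⁻¹ : X ≃ₜ X) '' K ⊆ {r}ᶜ := by
    rintro _ ⟨x, hx, rfl⟩ hxr
    exact hKr hx (by rw [Set.mem_singleton_iff] at hxr ⊢; rw [← hxr, hk])
  exact (h _ (hK.image (k⁻¹ : X ≃ₜ X).continuous) hKr' _ (k.continuous.continuousAt hV)).mono
    fun n hn x hx => hn _ ⟨x, hx, rfl⟩

variable {ρ : G →* (X ≃ₜ X)} {g : ℕ → G} {r a : X}

lemma IsConvergenceSequence.inv [R1Space X] (h : IsConvergenceSequence ρ g r a) :
    IsConvergenceSequence ρ (fun n => (g n)⁻¹) a r :=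
  ⟨inv_injective.comp h.1, h.2.2, by simpa using h.2.1⟩

lemma IsConvergenceSequence.conj [T2Space X] (h : IsConvergenceSequence ρ g r a) (k : G) :
    IsConvergenceSequence ρ (fun n => k * g n * k⁻¹) (ρ k r) (ρ k a) := by
  refine ⟨fun m n hmn => h.1 (by simpa using hmn), ?_, ?_⟩
  · simpa using h.2.1.conj (ρ k)
  · simpa [mul_assoc] using h.2.2.conj (ρ k)

lemma exists_isConvergenceSequence [R1Space X] [Infinite G] (h : IsConvergenceAction ρ) :
    ∃ g r a, IsConvergenceSequence ρ g r a := by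
  obtain ⟨φ, -, r, a, hg⟩ := h.2 _ (Infinite.natEmbedding G).injective
  exact ⟨_, r, a, hg⟩

lemma IsConvergenceAction.comp [R1Space X] (h : IsConvergenceAction ρ) {π : H →* G}
    (hπ : Function.Injective π) : IsConvergenceAction (ρ.comp π) := by
  refine ⟨h.1, fun g hg => ?_⟩
  obtain ⟨φ, hφ, r, a, -, h1, h2⟩ := h.2 _ (hπ.comp hg)
  exact ⟨φ, hφ, r, a, hg.comp hφ.injective, h1, by simpa using h2⟩

/-- The convergence property passes to actions of quotients: sequences of the quotient lift. -/
lemma IsConvergenceAction.of_comp [R1Space X] {π : H →* G} (hπ : Function.Surjective π)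
    (h : IsConvergenceAction (ρ.comp π)) : IsConvergenceAction ρ := by
  refine ⟨h.1, fun g hg => ?_⟩
  obtain ⟨s, hs⟩ := hπ.hasRightInverse
  obtain ⟨φ, hφ, r, a, -, h1, h2⟩ := h.2 (s ∘ g) (hs.injective.comp hg)
  refine ⟨φ, hφ, r, a, hg.comp hφ.injective, ?_, ?_⟩
  · simpa [hs _] using h1
  · simpa [hs _] using h2

variable [T2Space X]

/-- The elements of a sequence that eventually fix each point of `X ∖ {a}` are finite in number:
otherwise a subsequence of different elements would converge off `{a, r}` both to the identity and to
a constant. -/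
lemma finite_range_of_eventually_fixed [Infinite X] (h : IsConvergenceAction ρ) {u : ℕ → G} {a : X}
    (hu : ∀ x, x ≠ a → ∀ᶠ n in atTop, ρ (u n) x = x) : (Set.range u).Finite := by
  by_contra hinf
  let e := Set.Infinite.natEmbedding _ hinf
  choose ψ hψ using fun n => (e n).2
  have huψ : Function.Injective (u ∘ ψ) := fun m n hmn =>
    e.injective (Subtype.ext (by simpa [hψ] using hmn))
  obtain ⟨φ, hφ, r, b, -, hb, -⟩ := h.2 _ huψ
  have hlim : Tendsto (ψ ∘ φ) atTop atTop :=
    (huψ.of_comp.comp hφ.injective).nat_tendsto_atTop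
  have key : ∀ x, x ≠ a → x ≠ r → x = b := fun x hxa hxr =>
    tendsto_nhds_unique
      (tendsto_const_nhds.congr' ((hlim.eventually (hu x hxa)).mono fun n hn => hn.symm))
      (hb.tendsto hxr)
  obtain ⟨x, hx⟩ := (Set.toFinite {a, r, b}).exists_notMem
  simp only [Set.mem_insert_iff, Set.mem_singleton_iff, not_or] at hx
  exact hx.2.2 (key x hx.1 hx.2.1)

lemma finite_ker [Infinite X] (h : IsConvergenceAction ρ) : Finite ρ.ker := by
  by_contra hinf
  have : Infinite ρ.ker := not_finite_iff_infinite.1 hinf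
  let e := Infinite.natEmbedding ρ.ker
  have hfin := finite_range_of_eventually_fixed h (u := fun n => (e n : G)) (a := h.1.choose)
    fun x _ => Eventually.of_forall fun n => by rw [MonoidHom.mem_ker.1 (e n).2]; rfl
  exact Set.infinite_range_of_injective (Subtype.val_injective.comp e.injective) hfin

/-! ### Minimal convergence actions -/

/-- A faithful and minimal convergence action. On an infinite space such an action is automatically
non-elementary. -/
structure IsFaithfulMinimalConvergence (ρ : G →* (X ≃ₜ X)) : Prop where
  convergence : IsConvergenceAction ρ
  minimal : IsMinimalAction ρ
  faithful : Function.Injective ρ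

namespace IsFaithfulMinimalConvergence

/-- The set of common fixed points of a normal subgroup is closed and invariant, so that, by
minimality, it cannot contain a point `x` unless the subgroup acts trivially. -/
lemma exists_ne_of_normal (h : IsFaithfulMinimalConvergence ρ) {N : Subgroup G} [hN : N.Normal]
    (hne : N ≠ ⊥) (x : X) : ∃ n ∈ N, ρ n x ≠ x := by
  by_contra! hx
  refine hne ((Subgroup.eq_bot_iff_forall _).2 fun n hn => h.faithful ?_)
  have hd : Dense {y | ∀ n ∈ N, ρ n y = y} := by
    refine h.minimal.dense_of_invariant ⟨x, hx⟩ fun g y hy n hn => ?_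
    have := hy _ (hN.conj_mem n hn g⁻¹)
    rw [inv_inv, map_mul_apply, map_mul_apply] at this
    rw [← map_apply_inv_self ρ g (ρ n (ρ g y)), this]
  rw [map_one]
  refine Homeomorph.ext fun y => ?_
  exact congrFun (Continuous.ext_on hd (ρ n).continuous continuous_id fun y hy => hy n hn) y

variable [Infinite X]

/-- If `N` were finite, conjugation by a convergence sequence of `G` would, along subsequences, be
constant on `N`, and the attracting point would be fixed by `N`. -/
lemma infinite_of_normal (h : IsFaithfulMinimalConvergence ρ) {N : Subgroup G} [hN : N.Normal]
    (hne : N ≠ ⊥) : Infinite N := by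
  by_contra hfin
  have : Finite N := not_infinite_iff_finite.1 hfin
  have := h.minimal.infinite_group
  obtain ⟨g, r, a, hg⟩ := exists_isConvergenceSequence h.convergence
  obtain ⟨n, hn, hna⟩ := h.exists_ne_of_normal hne a
  obtain ⟨m, hm⟩ : ∃ m : N, ∃ᶠ i in atTop, (g i)⁻¹ * n * g i = m := by
    by_contra! hm
    obtain ⟨i, hi⟩ := (eventually_all.2 hm).exists
    exact hi ⟨_, by simpa using hN.conj_mem n hn (g i)⁻¹⟩ rfl
  obtain ⟨x, hx⟩ := (Set.toFinite {r, ρ (m : G)⁻¹ r}).exists_notMem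
  simp only [Set.mem_insert_iff, Set.mem_singleton_iff, not_or] at hx
  have hx' : ρ m x ≠ r := fun hxr => hx.2 (by rw [← hxr, map_inv_apply_self])
  have h1 : Tendsto (fun i => ρ n (ρ (g i) x)) atTop (𝓝 (ρ n a)) :=
    ((ρ n).continuous.tendsto a).comp (hg.2.1.tendsto hx.1)
  refine hna (tendsto_nhds_unique_of_frequently_eq h1 (hg.2.1.tendsto hx') (hm.mono fun i hi => ?_))
  rw [← map_mul_apply, ← map_mul_apply, ← hi]
  congr 2
  group

/-- The repelling points of convergence sequences inside a nontrivial normal subgroup are dense. -/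
lemma dense_repelling_of_normal (h : IsFaithfulMinimalConvergence ρ) {N : Subgroup G}
    [hN : N.Normal] (hne : N ≠ ⊥) :
    Dense {r | ∃ g : ℕ → G, (∀ n, g n ∈ N) ∧ ∃ a, IsConvergenceSequence ρ g r a} := by
  have := h.infinite_of_normal hne
  refine h.minimal.dense_of_invariant ?_ ?_
  · obtain ⟨g, r, a, hg, h1, h2⟩ :=
      exists_isConvergenceSequence (h.convergence.comp N.subtype_injective)
    exact ⟨r, fun n => g n, fun n => (g n).2, a, Subtype.val_injective.comp hg, h1, h2⟩
  · rintro k r ⟨g, hg, a, hga⟩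
    exact ⟨_, fun n => hN.conj_mem _ (hg n) k, _, hga.conj k⟩

lemma exists_repelling_mem (h : IsFaithfulMinimalConvergence ρ) {U : Set X} (hU : IsOpen U)
    (hne : U.Nonempty) : ∃ r ∈ U, ∃ g a, IsConvergenceSequence ρ g r a := by
  have := h.minimal.infinite_group
  obtain ⟨r, hrU, g, -, a, hg⟩ := (h.dense_repelling_of_normal (N := ⊤) top_ne_bot).exists_mem_open
    hU hne |>.imp fun _ => And.symm
  exact ⟨r, hrU, g, a, hg⟩

/-- The orbit closure of any point `x` under `N` contains every repelling point `r` of `N`: apply the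
inverse sequence to `x`, or to a translate of `x` if `x` is the attracting point. -/
lemma restrict_normal (h : IsFaithfulMinimalConvergence ρ) (N : Subgroup G) [N.Normal]
    (hne : N ≠ ⊥) : IsFaithfulMinimalConvergence (ρ.comp N.subtype) := by
  refine ⟨h.convergence.comp N.subtype_injective, fun x => ?_, h.faithful.comp N.subtype_injective⟩
  rw [← dense_closure]
  refine (h.dense_repelling_of_normal hne).mono ?_
  rintro r ⟨g, hgN, a, hg⟩
  obtain ⟨k, hk, hka⟩ : ∃ k ∈ N, ρ k x ≠ a := by
    by_cases hxa : x = a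
    · obtain ⟨n, hn, hnx⟩ := h.exists_ne_of_normal hne x
      exact ⟨n, hn, hxa ▸ hnx⟩
    · exact ⟨1, N.one_mem, by simpa using hxa⟩
  refine mem_closure_of_tendsto (hg.2.2.tendsto hka) (Eventually.of_forall fun n => ?_)
  exact ⟨⟨(g n)⁻¹ * k, N.mul_mem (N.inv_mem (hgN n)) hk⟩, map_mul_apply ρ _ _ _⟩

/-- The action is topologically free. -/
lemma interior_fixedPoints_eq_empty (h : IsFaithfulMinimalConvergence ρ) {f : G} (hf : f ≠ 1) :
    interior {x | ρ f x = x} = ∅ := by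
  by_contra hne
  set U := interior {x | ρ f x = x} with hU
  obtain ⟨r, hr, g, a, hg⟩ :=
    h.exists_repelling_mem isOpen_interior (Set.nonempty_iff_ne_empty.2 hne)
  -- The conjugate `g n * f * (g n)⁻¹` fixes `ρ (g n) U`, which exhausts `X ∖ {a}`.
  have hfix : ∀ x, x ≠ a → ∀ᶠ n in atTop, ρ (g n * f * (g n)⁻¹) x = x := by
    intro x hx
    filter_upwards [convergesOffPoint_iff.1 hg.2.1 Uᶜ isOpen_interior.isClosed_compl.isCompact
      (by simpa using hr) {x}ᶜ (isOpen_compl_singleton.mem_nhds hx.symm)] with n hn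
    have hxU : ρ (g n)⁻¹ x ∈ U := by
      by_contra hxU
      exact hn _ hxU (map_apply_inv_self ρ _ _)
    rw [map_mul_apply, map_mul_apply, interior_subset hxU, map_apply_inv_self]
  have hfin := finite_range_of_eventually_fixed h.convergence hfix
  -- Only finitely many conjugates occur, so one of them, `k`, occurs infinitely often.
  obtain ⟨k, hk⟩ : ∃ k : G, ∃ᶠ n in atTop, g n * f * (g n)⁻¹ = k := by
    by_contra! hk
    obtain ⟨n, hn⟩ := ((eventually_all_finite hfin).2 fun k _ => hk k).exists
    exact hn _ ⟨n, rfl⟩ rfl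
  have hkx : ∀ x, x ≠ a → ρ k x = x := by
    intro x hx
    obtain ⟨n, hn, hnx⟩ := (hk.and_eventually (hfix x hx)).exists
    rw [← hn, hnx]
  have hka : ρ k a = a := by
    by_contra hka
    exact hka ((ρ k).injective (hkx _ hka))
  have hk1 : k = 1 := h.faithful <| by
    rw [map_one]
    refine Homeomorph.ext fun x => ?_
    by_cases hx : x = a
    · rw [hx]; exact hka
    · exact hkx x hx
  obtain ⟨n, hn⟩ := hk.exists
  exact hf (by simpa [hk1] using hn)

/-! ### Powers groups -/

/-- A small neighbourhood of a point that no element of `F` fixes is moved off itself by all of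
them. -/
lemma exists_open_disjoint (h : IsFaithfulMinimalConvergence ρ) (F : Finset G) (hF : (1 : G) ∉ F) :
    ∃ U : Set X, IsOpen U ∧ U.Nonempty ∧ ∀ f ∈ F, ∀ x ∈ U, ρ f x ∉ U := by
  have hclosed : ∀ f, IsClosed {x | ρ f x = x} := fun f =>
    isClosed_eq (ρ f).continuous continuous_id
  have hd : Dense (⋂ f ∈ F, {x | ρ f x = x}ᶜ) := by
    refine dense_biInter_of_isOpen (fun f _ => (hclosed f).isOpen_compl) F.countable_toSet
      fun f hf => ?_
    exact interior_eq_empty_iff_dense_compl.1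
      (h.interior_fixedPoints_eq_empty fun hf1 => hF (hf1 ▸ hf))
  obtain ⟨x, hx⟩ := hd.nonempty
  simp only [Set.mem_iInter, Set.mem_compl_iff, Set.mem_ofPred_eq] at hx
  have hev : ∀ f ∈ F, ∃ W ∈ 𝓝 x, ∀ y ∈ W, ρ f y ∉ W := by
    intro f hf
    obtain ⟨A, B, hA, hB, hAB⟩ := t2_separation_nhds (hx f hf)
    exact ⟨B ∩ ρ f ⁻¹' A, inter_mem hB ((ρ f).continuous.continuousAt hA), fun y hy hy' =>
      Set.disjoint_left.1 hAB hy.2 hy'.1⟩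
  choose! W hW hWd using hev
  have hmem : (⋂ f ∈ F, W f) ∈ 𝓝 x := (biInter_finset_mem F).2 hW
  refine ⟨interior (⋂ f ∈ F, W f), isOpen_interior, ⟨x, mem_interior_iff_mem_nhds.2 hmem⟩, ?_⟩
  intro f hf y hy hy'
  exact hWd f hf y (Set.mem_iInter₂.1 (interior_subset hy) f hf)
    (Set.mem_iInter₂.1 (interior_subset hy') f hf)

/-- A convergence sequence contracts `X ∖ U` to a small neighbourhood of its attracting point `a`, and
the infinite orbit of `a` provides `N` disjoint translates of this neighbourhood. -/
lemma exists_translates_compl_disjoint (h : IsFaithfulMinimalConvergence ρ) {U : Set X}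
    (hU : IsOpen U) (hne : U.Nonempty) (N : ℕ) :
    ∃ γ : Fin N → G, ∀ j k, j ≠ k → ∀ x ∉ U, ∀ y ∉ U, ρ (γ j) x ≠ ρ (γ k) y := by
  obtain ⟨r, hr, g, a, hg⟩ := h.exists_repelling_mem hU hne
  let e := Set.Infinite.natEmbedding _ (h.minimal.infinite_orbit a)
  choose t ht using fun n => (e n).2
  have hinj : Function.Injective fun j : Fin N => ρ (t j) a := fun j k hjk =>
    Fin.ext (e.injective (Subtype.ext (by simpa [ht] using hjk)))
  obtain ⟨V, hV, hdisj⟩ :=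
    (pairwise_disjoint_nhds.comp_of_injective hinj).exists_mem_filter_of_disjoint
  have hmem : (⋂ j : Fin N, ρ (t j) ⁻¹' V j) ∈ 𝓝 a :=
    iInter_mem.2 fun j => (ρ (t j)).continuous.continuousAt (hV j)
  obtain ⟨n, hn⟩ := (convergesOffPoint_iff.1 hg.2.1 Uᶜ hU.isClosed_compl.isCompact
    (by simpa using hr) _ hmem).exists
  refine ⟨fun j => t j * g n, fun j k hjk x hx y hy hxy => ?_⟩
  rw [map_mul_apply, map_mul_apply] at hxy
  refine Set.disjoint_left.1 (hdisj hjk) (Set.mem_iInter.1 (hn x hx) j) ?_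
  rw [hxy]
  exact Set.mem_iInter.1 (hn y hy) k

/-- The partition of `X` into `U` and `X ∖ U` is pulled back to `G` along an orbit map. -/
theorem isPowersGroup (h : IsFaithfulMinimalConvergence ρ) : IsPowersGroup G := by
  intro F hF N _
  obtain ⟨U, hU, hne, hUF⟩ := h.exists_open_disjoint F hF
  obtain ⟨γ, hγ⟩ := h.exists_translates_compl_disjoint hU hne N
  obtain ⟨x₀⟩ : Nonempty X := inferInstance
  refine ⟨{g | ρ g x₀ ∈ U}, {g | ρ g x₀ ∈ U}ᶜ, Set.union_compl_self _, disjoint_compl_right, γ,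
    fun f hf => Set.disjoint_left.2 ?_, fun j k hjk => Set.disjoint_left.2 ?_⟩
  · rintro _ ⟨g, hg, rfl⟩ hfg
    exact hUF f hf _ hg (by simpa [map_mul_apply] using hfg)
  · rintro _ ⟨g, hg, rfl⟩ ⟨g', hg', hgg'⟩
    refine hγ j k hjk _ hg _ hg' ?_
    rw [← map_mul_apply, ← map_mul_apply]
    exact congrArg (fun u => ρ u x₀) hgg'.symm

lemma restrict_subnormal (h : IsFaithfulMinimalConvergence ρ) {N : Subgroup G}
    (hN : N.IsSubnormal) (hne : N ≠ ⊥) : IsFaithfulMinimalConvergence (ρ.comp N.subtype) := by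
  induction hN with
  | top =>
    exact h.restrict_normal ⊤ hne
  | step A B hAB _ hA ih =>
    have hB := ih fun hB => hne (le_bot_iff.1 (hB ▸ hAB))
    have hA' := hB.restrict_normal (A.subgroupOf B) fun hbot =>
      hne ((Subgroup.subgroupOf_eq_bot.1 hbot).eq_bot_of_le hAB)
    let π : A.subgroupOf B →* A := (Subgroup.subgroupOfEquivOfLe hAB).toMonoidHom
    have hπ : (ρ.comp A.subtype).comp π = (ρ.comp B.subtype).comp (A.subgroupOf B).subtype := rfl
    rw [← hπ] at hA'
    exact ⟨hA'.convergence.of_comp (Subgroup.subgroupOfEquivOfLe hAB).surjective,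
      hA'.minimal.of_comp, h.faithful.comp A.subtype_injective⟩

theorem isStronglyPowersGroup (h : IsFaithfulMinimalConvergence ρ) : IsStronglyPowersGroup G :=
  fun _ hN hne => (h.restrict_subnormal hN hne).isPowersGroup

end IsFaithfulMinimalConvergence

lemma isFaithfulMinimalConvergence_kerLift (hconv : IsConvergenceAction ρ)
    (hmin : IsMinimalAction ρ) : IsFaithfulMinimalConvergence (QuotientGroup.kerLift ρ) :=
  ⟨IsConvergenceAction.of_comp (π := QuotientGroup.mk' ρ.ker) (QuotientGroup.mk'_surjective _)
      hconv,
    IsMinimalAction.of_comp (π := QuotientGroup.mk' ρ.ker) hmin,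
    QuotientGroup.kerLift_injective ρ⟩

end ConvergenceSequences

/-! ### Amenability -/

section Amenability

variable {G H : Type*} [Group G] [Group H]

lemma isAmenableGroup_of_finite [Finite G] : IsAmenableGroup G := by
  have hG : (Nat.card G : NNReal) ≠ 0 := by exact_mod_cast Nat.card_pos.ne'
  refine ⟨fun A => A.ncard / Nat.card G, ?_, fun A B hAB => ?_, fun g A => ?_⟩
  · simp [Set.ncard_univ, hG]
  · simp [Set.ncard_union_eq hAB, add_div]
  · simp [Set.ncard_smul_set]

lemma IsAmenableGroup.of_surjective (h : IsAmenableGroup G) {π : G →* H}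
    (hπ : Function.Surjective π) : IsAmenableGroup H := by
  obtain ⟨μ, h1, hadd, hinv⟩ := h
  refine ⟨fun A => μ (π ⁻¹' A), h1, fun A B hAB => hadd _ _ (hAB.preimage π), fun h A => ?_⟩
  obtain ⟨g, rfl⟩ := hπ h
  change μ _ = μ _
  rw [← hinv g (π ⁻¹' A)]
  congr 1
  ext x
  simp [Set.mem_smul_set_iff_inv_smul_mem]

/-- In the definition of a Powers group with `F = {f}` and `N = 3`, an invariant mean would give
`C` mass at most `1 / 2` and `D` mass at most `1 / 3`. -/
lemma IsPowersGroup.not_isAmenableGroup [Nontrivial G] (h : IsPowersGroup G) :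
    ¬ IsAmenableGroup G := by
  rintro ⟨μ, h1, hadd, hinv⟩
  have hle : ∀ A, μ A ≤ 1 := fun A => by
    rw [← h1, ← Set.union_compl_self A, hadd _ _ disjoint_compl_right]
    exact le_self_add
  obtain ⟨f, hf⟩ := exists_ne (1 : G)
  obtain ⟨C, D, hCD, hdisj, γ, hC, hD⟩ := h {f} (by simpa using hf.symm) 3 (by norm_num)
  have hC2 := hle (f • C ∪ C)
  rw [hadd _ _ (hC f (by simp)), hinv] at hC2
  have hD3 := hle ((γ 0 • D ∪ γ 1 • D) ∪ γ 2 • D)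
  rw [hadd _ _ (Set.disjoint_union_left.2 ⟨hD _ _ (by decide), hD _ _ (by decide)⟩),
    hadd _ _ (hD _ _ (by decide)), hinv, hinv, hinv] at hD3
  have hsum := hadd C D hdisj
  rw [hCD, h1] at hsum
  have hC' : (μ C : ℝ) + μ C ≤ 1 := by exact_mod_cast hC2
  have hD' : (μ D : ℝ) + μ D + μ D ≤ 1 := by exact_mod_cast hD3
  have hs' : (1 : ℝ) = μ C + μ D := by exact_mod_cast hsum
  linarith

/-- The image of `N` in `G ⧸ K` is normal and amenable, hence trivial, since it would otherwise be a
nontrivial Powers group. -/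
lemma IsStronglyPowersGroup.le_of_isAmenableGroup {K : Subgroup G} [K.Normal]
    (h : IsStronglyPowersGroup (G ⧸ K)) {N : Subgroup G} [N.Normal] (hN : IsAmenableGroup N) :
    N ≤ K := by
  set M := N.map (QuotientGroup.mk' K) with hM
  have hMn : M.Normal := ‹N.Normal›.map _ (QuotientGroup.mk'_surjective K)
  by_cases hbot : M = ⊥
  · rw [hM, Subgroup.map_eq_bot_iff, QuotientGroup.ker_mk'] at hbot
    exact hbot
  · have := (Subgroup.nontrivial_iff_ne_bot M).2 hbot
    exact absurd (hN.of_surjective ((QuotientGroup.mk' K).subgroupMap_surjective N))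
      (h M hMn.isSubnormal hbot).not_isAmenableGroup

end Amenability

theorem corollary1p3 {G X : Type*} [Group G] [Countable G]
    [TopologicalSpace X] [CompactSpace X] [TopologicalSpace.MetrizableSpace X]
    (ρ : G →* (X ≃ₜ X)) (hconv : IsConvergenceAction ρ)
    (hmin : IsMinimalAction ρ) (hne : IsNonElementary ρ) :
    IsGreatest {N : Subgroup G | N.Normal ∧ IsAmenableGroup N} (amenableRadical G) ∧
      Finite (amenableRadical G) ∧
      amenableRadical G = ρ.ker ∧
      IsStronglyPowersGroup (G ⧸ amenableRadical G) := by
  have : Infinite X := Set.infinite_univ_iff.1 (hne.mono (Set.subset_univ _))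
  have hfin := finite_ker hconv
  have hpow : IsStronglyPowersGroup (G ⧸ ρ.ker) :=
    (isFaithfulMinimalConvergence_kerLift hconv hmin).isStronglyPowersGroup
  have hgr : IsGreatest {N : Subgroup G | N.Normal ∧ IsAmenableGroup N} ρ.ker :=
    ⟨⟨inferInstance, isAmenableGroup_of_finite⟩, fun N hN =>
      have := hN.1
      hpow.le_of_isAmenableGroup hN.2⟩
  have hker : amenableRadical G = ρ.ker := hgr.isLUB.sSup_eq
  refine ⟨hker ▸ hgr, hker ▸ hfin, hker, ?_⟩
  have transfer : ∀ (K : Subgroup G) [K.Normal], K = ρ.ker → IsStronglyPowersGroup (G ⧸ K) := by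
    rintro _ _ rfl
    exact hpow
  exact transfer _ hker
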